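/- **Theorem (Konno–Kuroda formula).** Let $\mathscr H$ and $\mathfrak X$ be complex Hilbert spaces, let $H_0\ge 0$ be a self-adjoint operator in $\mathscr H$, let $A:D(A)\subset\mathscr H\to\mathfrak X$ be densely defined and closed with $D(A)\supset D(H_0)$, let $J\in\mathscr L(\mathfrak X)$ be a self-adjoint isometry, and let $B=JA$ with $D(B)=D(A)$. Suppose that $B\,D(H_0)\subset D(A^*)$ and that $A^*A$ and $A^*B$ are $H_0$-bounded with relative bound less than one (in particular their domains contain $D(H_0)$). Let $H=H_0-A^*B$, with domain $D(H_0)$. For a closed operator $T$ in $\mathscr H$ let $\rho(T)$ denote the set of $z\in\mathbb C$ for which $T+z:D(T)\to\mathscr H$ is a bijection (this differs by a sign from the usual convention). For $z\in\rho(H_0)$ put $R_0(z)=(H_0+z)^{-1}$ and $\phi(z)=BR_0(z)A^*$, with domain $D(A^*)$. Let $z\in\rho(H_0)$. Then $\phi(z)$ is bounded, so that it has a unique extension to a bounded operator on $\mathfrak X$, again denoted by $\phi(z)$. The operator $1-\phi(z)$ has a bounded inverse on $\mathfrak X$ if and only if $z\in\rho(H_0)\cap\rho(H)$, and in this case $$(H+z)^{-1}=R_0(z)+R_0(z)A^*(1-\phi(z))^{-1}BR_0(z)\quad\text{on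 }\mathscr H,$$ where $(1-\phi(z))^{-1}BR_0(z)$ maps $\mathscr H$ into $D(A^*)$, and $$(1-\phi(z))^{-1}=1+B(H+z)^{-1}A^*\quad\text{on the dense subspace }D(A^*)\subset\mathfrak X.$$ No compactness of $\phi(z)$ is assumed. -/

import Mathlib

open scoped LinearPMap

noncomputable section

namespace KonnoKuroda

section Basic

variable {E F G : Type*}
  [NormedAddCommGroup E] [InnerProductSpace ℂ E]
  [NormedAddCommGroup F] [InnerProductSpace ℂ F]
  [NormedAddCommGroup G] [InnerProductSpace ℂ G]

/-- The product `S T` of two unbounded operators on its natural domain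
`{x ∈ D(T) | T x ∈ D(S)}`. -/
def pcomp (S : F →ₗ.[ℂ] G) (T : E →ₗ.[ℂ] F) : E →ₗ.[ℂ] G :=
  S.comp (T.domRestrict ((S.domain.comap T.toFun).map T.domain.subtype)) (by
    rintro ⟨x, hx, hx'⟩
    obtain ⟨y, hy, rfl⟩ := hx
    exact hy)

infixr:80 " ⊚ " => pcomp

theorem mem_pcomp_domain (S : F →ₗ.[ℂ] G) (T : E →ₗ.[ℂ] F) (x : E) :
    x ∈ (S ⊚ T).domain ↔ ∃ h : x ∈ T.domain, T ⟨x, h⟩ ∈ S.domain := by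
  constructor
  · rintro ⟨⟨y, hy, rfl⟩, hx'⟩
    exact ⟨hx', hy⟩
  · rintro ⟨h, h'⟩
    exact ⟨⟨⟨x, h⟩, h', rfl⟩, h⟩

theorem pcomp_apply (S : F →ₗ.[ℂ] G) (T : E →ₗ.[ℂ] F) (x : E)
    (hx : x ∈ (S ⊚ T).domain) (h : x ∈ T.domain) (h' : T ⟨x, h⟩ ∈ S.domain) :
    (S ⊚ T) ⟨x, hx⟩ = S ⟨T ⟨x, h⟩, h'⟩ := rfl

/-- A bounded operator, regarded as an unbounded operator with domain the whole space. -/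
def full (T : E →L[ℂ] F) : E →ₗ.[ℂ] F := T.toLinearMap.toPMap ⊤

/-- `T + z` with domain `D(T)`. -/
def shift (T : E →ₗ.[ℂ] E) (z : ℂ) : E →ₗ.[ℂ] E :=
  (z • (LinearMap.id : E →ₗ[ℂ] E)) +ᵥ T

theorem shift_apply (T : E →ₗ.[ℂ] E) (z : ℂ) (x : T.domain) :
    shift T z x = z • (x : E) + T x := rfl

/-- The resolvent set in the sign convention `z ∈ ρ(T)` iff `T + z : D(T) → E` is a bijection.
For closed `T` the inverse is then automatically bounded. -/
def rho (T : E →ₗ.[ℂ] E) : Set ℂ := {z | Function.Bijective (shift T z)}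

/-- `(T + z)⁻¹`; its domain is the range of `T + z`, which is all of `E` for `z ∈ rho T`. -/
def res (T : E →ₗ.[ℂ] E) (z : ℂ) : E →ₗ.[ℂ] E := (shift T z).inverse

/-- `T` is `S`-bounded with relative bound less than one: `D(S) ⊆ D(T)` and
`‖T x‖ ≤ a ‖S x‖ + b ‖x‖` on `D(S)` for some `a < 1` and some `b`. -/
def RelBoundLTOne (T : E →ₗ.[ℂ] F) (S : E →ₗ.[ℂ] G) : Prop :=
  ∃ hST : S.domain ≤ T.domain, ∃ a b : ℝ, 0 ≤ a ∧ a < 1 ∧ 0 ≤ b ∧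
    ∀ x : S.domain, ‖T ⟨x, hST x.2⟩‖ ≤ a * ‖S x‖ + b * ‖(x : E)‖

end Basic

section Model

variable {𝓗 X : Type*}
  [NormedAddCommGroup 𝓗] [InnerProductSpace ℂ 𝓗] [CompleteSpace 𝓗]
  [NormedAddCommGroup X] [InnerProductSpace ℂ X]

/-- `B = J A`, with domain `D(A)`. -/
def opB (A : 𝓗 →ₗ.[ℂ] X) (J : X →L[ℂ] X) : 𝓗 →ₗ.[ℂ] X := full J ⊚ A

/-- `H = H₀ - A* B` on its natural domain `D(H₀) ∩ D(A* B)`. -/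
def ham (H₀ : 𝓗 →ₗ.[ℂ] 𝓗) (A : 𝓗 →ₗ.[ℂ] X) (J : X →L[ℂ] X) : 𝓗 →ₗ.[ℂ] 𝓗 :=
  H₀ - A† ⊚ opB A J

/-- `φ(z) = B (H₀ + z)⁻¹ A*` on its natural domain. -/
def phi (H₀ : 𝓗 →ₗ.[ℂ] 𝓗) (A : 𝓗 →ₗ.[ℂ] X) (J : X →L[ℂ] X) (z : ℂ) : X →ₗ.[ℂ] X :=
  opB A J ⊚ res H₀ z ⊚ A†

end Model

end KonnoKuroda

end

/-! ### Form bounds from norm bounds -/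

namespace KonnoKuroda

/-! Algebraically, `(1 - φ(z)) B = B R₀(z) (H + z)` on `D(H₀)`, so inverting `1 - φ(z)` and
inverting `H + z` are equivalent up to boundedness and domain questions. Those are the real content.

Boundedness comes from quadratic forms. For symmetric operators a norm bound by `H₀ + l` implies the
same form bound (`abs_re_inner_le`). Applied to `A*A` it gives `‖A x‖² ≤ C (x, (H₀ + l) x)`; applied
to `A*B`, with `l` so large that the bound is some `q < 1`, it shows that the form of `H + l`
dominates `1 - q` times that of `H₀ + l`. Hence `A R A*` and `R A*` are bounded for the resolvents
`R` of both operators (`exists_bound_of_form_bound`).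

If `H + z` is bijective, the extension of `1 + B (H + z)⁻¹ A*` inverts `1 - Φ`. Conversely, if `(1 -
Φ) u = B R₀(z) y`, then `R₀(z) y` plus the extension of `R₀(z) A*` at `u` should solve `(H + z) f =
y`. As `u` need not lie in `D(A*)`, membership of `f` in the domain is obtained by rewriting `f`
through `(H + l)⁻¹` (`konnoKuroda_of_form_bound`). -/

/-- Log-convexity makes the ratios `m (n + 1) / m n` nondecreasing, so a first ratio above `Q` would
force growth faster than `C * Q ^ n`. -/
theorem le_mul_of_sq_le_mul {m : ℕ → ℝ} (h0 : ∀ n, 0 ≤ m n)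
    (hm : ∀ n, m (n + 1) ^ 2 ≤ m n * m (n + 2)) {C Q : ℝ} (hQ : 0 ≤ Q)
    (hb : ∀ n, m n ≤ C * Q ^ n) : m 1 ≤ Q * m 0 := by
  by_contra! hlt
  have h1 : 0 < m 1 := lt_of_le_of_lt (mul_nonneg hQ (h0 0)) hlt
  have h00 : 0 < m 0 := by
    rcases (h0 0).lt_or_eq with h | h
    · exact h
    · have := hm 0
      rw [← h] at this
      nlinarith
  set r := m 1 / m 0 with hr
  have hr0 : 0 < r := div_pos h1 h00
  have hQr : Q < r := (lt_div_iff₀ h00).2 hlt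
  have step : ∀ n, 0 < m n ∧ r * m n ≤ m (n + 1) := by
    intro n
    induction n with
    | zero => exact ⟨h00, by rw [hr, div_mul_cancel₀ _ h00.ne']⟩
    | succ n ih =>
      have hp : 0 < m (n + 1) := lt_of_lt_of_le (mul_pos hr0 ih.1) ih.2
      refine ⟨hp, le_of_mul_le_mul_left ?_ ih.1⟩
      calc m n * (r * m (n + 1)) = (r * m n) * m (n + 1) := by ring
        _ ≤ m (n + 1) * m (n + 1) := by gcongr; exact ih.2
        _ ≤ m n * m (n + 2) := by rw [← sq]; exact hm n
  have geo : ∀ n, r ^ n * m 0 ≤ m n := by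
    intro n
    induction n with
    | zero => simp
    | succ n ih =>
      calc r ^ (n + 1) * m 0 = r * (r ^ n * m 0) := by ring
        _ ≤ r * m n := by gcongr
        _ ≤ _ := (step n).2
  have key : ∀ n, m 0 ≤ C * (Q / r) ^ n := by
    intro n
    rw [div_pow, ← mul_div_assoc, le_div_iff₀ (pow_pos hr0 n), mul_comm]
    exact (geo n).trans (hb n)
  have lim := (tendsto_pow_atTop_nhds_zero_of_lt_one (div_nonneg hQ hr0.le)
    ((div_lt_one hr0).2 hQr)).const_mul C
  rw [mul_zero] at lim
  exact absurd (ge_of_tendsto' lim key) (not_le.2 h00)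

section Form

variable {𝓗 D : Type*} [NormedAddCommGroup 𝓗] [InnerProductSpace ℂ 𝓗]
  [AddCommGroup D] [Module ℂ D]

/-- Cauchy–Schwarz for the energy form `(ι x, e y)`; real multiples of `y` suffice for real parts.
-/
theorem sq_re_inner_le (ι e : D →ₗ[ℂ] 𝓗)
    (hsym : ∀ x y, inner ℂ (e x) (ι y) = inner ℂ (ι x) (e y))
    (hpos : ∀ x, 0 ≤ (inner ℂ (ι x) (e x)).re) (x y : D) :
    (inner ℂ (ι x) (e y)).re ^ 2 ≤ (inner ℂ (ι x) (e x)).re * (inner ℂ (ι y) (e y)).re := by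
  have hyx : (inner ℂ (ι y) (e x)).re = (inner ℂ (ι x) (e y)).re := by
    rw [← hsym, ← inner_conj_symm, Complex.conj_re]
  have hq : ∀ t : ℝ, 0 ≤ (inner ℂ (ι y) (e y)).re * (t * t) +
      2 * (inner ℂ (ι x) (e y)).re * t + (inner ℂ (ι x) (e x)).re := by
    intro t
    have := hpos (x + (t : ℂ) • y)
    simp only [map_add, map_smul, inner_add_left, inner_add_right, inner_smul_left,
      inner_smul_right, Complex.add_re, Complex.conj_ofReal, Complex.re_ofReal_mul, hyx] at this
    linarith
  have := discrim_le_zero hq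
  rw [discrim] at this
  nlinarith

/-- Krein–Lax symmetrization: `N = e⁻¹ t` is symmetric for the energy form `(ι x, e y)`, and the
squared energy norms of `N ^ n x` are log-convex with growth at most `q ^ (2 n)`. So `N` contracts
the energy norm by `q`, and Cauchy–Schwarz bounds `(ι x, t x) = (ι x, e (N x))`. -/
theorem abs_re_inner_le (ι t : D →ₗ[ℂ] 𝓗) (e : D ≃ₗ[ℂ] 𝓗)
    (hsym : ∀ x y, inner ℂ (e x) (ι y) = inner ℂ (ι x) (e y))
    (hpos : ∀ x, 0 ≤ (inner ℂ (ι x) (e x)).re)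
    (ht : ∀ x y, inner ℂ (t x) (ι y) = inner ℂ (ι x) (t y)) {c q : ℝ} (hq : 0 ≤ q)
    (htq : ∀ x, ‖t x‖ ≤ q * ‖e x‖) (hc : ∀ x, ‖ι x‖ ≤ c * ‖e x‖) (x : D) :
    |(inner ℂ (ι x) (t x)).re| ≤ q * (inner ℂ (ι x) (e x)).re := by
  set N : D → D := fun y => e.symm (t y) with hN
  have eN : ∀ y, e (N y) = t y := fun y => by simp [hN]
  have hNs : ∀ y z, inner ℂ (ι (N y)) (e z) = inner ℂ (ι y) (e (N z)) := fun y z => by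
    rw [← hsym, eN, ht, eN]
  set u : ℕ → D := fun n => N^[n] x with hu
  have us : ∀ n, u (n + 1) = N (u n) := fun n => Function.iterate_succ_apply' N n x
  have hen : ∀ n, ‖e (u n)‖ ≤ q ^ n * ‖e x‖ := by
    intro n
    induction n with
    | zero => simp [hu]
    | succ n ih =>
      rw [us, eN, pow_succ', mul_assoc]
      exact (htq _).trans (by gcongr)
  set m : ℕ → ℝ := fun n => (inner ℂ (ι (u n)) (e (u n))).re with hm
  have h1 : m 1 ≤ q ^ 2 * m 0 := by
    refine le_mul_of_sq_le_mul (C := |c| * ‖e x‖ ^ 2) (fun n => hpos _) (fun n => ?_)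
      (by positivity) (fun n => ?_)
    · have : m (n + 1) = (inner ℂ (ι (u n)) (e (u (n + 2)))).re := by
        simp only [hm]
        rw [us (n + 1), ← hNs, ← us]
      exact (congrArg (· ^ 2) this).trans_le (sq_re_inner_le ι e hsym hpos _ _)
    · calc m n ≤ ‖ι (u n)‖ * ‖e (u n)‖ := re_inner_le_norm (𝕜 := ℂ) _ _
        _ ≤ (|c| * ‖e (u n)‖) * ‖e (u n)‖ := by
          gcongr
          exact (hc _).trans (by gcongr; exact le_abs_self c)
        _ = |c| * ‖e (u n)‖ ^ 2 := by ring
        _ ≤ |c| * (q ^ n * ‖e x‖) ^ 2 := by gcongr; exact hen n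
        _ = |c| * ‖e x‖ ^ 2 * (q ^ 2) ^ n := by ring
  have h2 := sq_re_inner_le ι e hsym hpos (u 0) (u 1)
  have e1 : e (u 1) = t x := eN x
  refine abs_le_of_sq_le_sq ?_ (mul_nonneg hq (hpos x))
  calc (inner ℂ (ι x) (t x)).re ^ 2 ≤ m 0 * m 1 := by rw [← e1]; exact h2
    _ ≤ m 0 * (q ^ 2 * m 0) := by gcongr; exact hpos _
    _ = _ := by simp only [hm, hu, Function.iterate_zero, id]; ring

end Form

/-! ### Bounded operators built from resolvents -/

section Core

variable {𝓗 X D : Type*} [NormedAddCommGroup 𝓗] [InnerProductSpace ℂ 𝓗] [CompleteSpace 𝓗]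
  [NormedAddCommGroup X] [InnerProductSpace ℂ X] [CompleteSpace X]
  [AddCommGroup D] [Module ℂ D] {V : Submodule ℂ X}

/-- A perturbation with `‖w x‖ ≤ q ‖e x‖`, `q < 1`, preserves
bijectivity. -/
theorem bijective_sub_of_le (e : D ≃ₗ[ℂ] 𝓗) (w : D →ₗ[ℂ] 𝓗) {q : ℝ} (hq : q < 1) (hq0 : 0 ≤ q)
    (hw : ∀ x, ‖w x‖ ≤ q * ‖e x‖) : Function.Bijective (e.toLinearMap - w) := by
  set W : 𝓗 →L[ℂ] 𝓗 := (w ∘ₗ e.symm.toLinearMap).mkContinuous q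
    (fun y => by simpa using hw (e.symm y)) with hW
  have hn : ‖W‖ < 1 := (LinearMap.mkContinuous_norm_le _ hq0 _).trans_lt hq
  have hb : Function.Bijective (1 - W : 𝓗 →L[ℂ] 𝓗) :=
    ContinuousLinearMap.isUnit_iff_bijective.1 (isUnit_one_sub_of_norm_lt_one hn)
  have : ⇑(e.toLinearMap - w) = (1 - W : 𝓗 →L[ℂ] 𝓗) ∘ e := by
    ext x; simp [hW]
  rw [this]
  exact hb.comp e.bijective

/-- If `e = g + l` has a bounded inverse and `e' = g + z` is bijective, then `e` is dominated by
`e'`. -/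
theorem exists_norm_le_of_shift (ι : D →ₗ[ℂ] 𝓗) (e e' : D ≃ₗ[ℂ] 𝓗) (d : ℂ)
    (hd : ∀ x, e' x = e x + d • ι x) {c : ℝ} (hc : ∀ x, ‖ι x‖ ≤ c * ‖e x‖) :
    ∃ C, 0 ≤ C ∧ ∀ x, ‖e x‖ ≤ C * ‖e' x‖ := by
  set P : 𝓗 →L[ℂ] 𝓗 := (ι ∘ₗ e.symm.toLinearMap).mkContinuous c
    (fun y => by simpa using hc (e.symm y)) with hP
  set N : 𝓗 →L[ℂ] 𝓗 := 1 + d • P with hN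
  have hNe : ∀ x, N (e x) = e' x := fun x => by simp [hN, hP, hd]
  -- `N = e' e⁻¹` is bounded and bijective, so its inverse `e e'⁻¹` is bounded by the open mapping
  -- theorem.
  have hb : Function.Bijective N := by
    have : ⇑N = e' ∘ e.symm := by
      ext y; simp [← hNe]
    rw [this]
    exact e'.bijective.comp e.symm.bijective
  obtain ⟨u, hu⟩ := ContinuousLinearMap.isUnit_iff_bijective.2 hb
  refine ⟨‖(↑u⁻¹ : 𝓗 →L[ℂ] 𝓗)‖, norm_nonneg _, fun x => ?_⟩
  have : (↑u⁻¹ : 𝓗 →L[ℂ] 𝓗) (e' x) = e x := by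
    rw [← hNe, ← hu, ← mul_apply_eq_comp, Units.inv_mul]; rfl
  rw [← this]
  exact ContinuousLinearMap.le_opNorm _ _

omit [CompleteSpace X] in
/-- Boundedness of `a (g + z)⁻¹ s` and `(g + z)⁻¹ s` where `s` is a formal adjoint of `a`. -/
theorem exists_bound_of_form_bound (ι : D →ₗ[ℂ] 𝓗) (a : D →ₗ[ℂ] X) (s : V →ₗ[ℂ] 𝓗)
    (hadj : ∀ v x, inner ℂ (s v) (ι x) = inner ℂ (v : X) (a x))
    (e e' : D ≃ₗ[ℂ] 𝓗) (d : ℂ) (hd : ∀ x, e' x = e x + d • ι x)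
    (hsym : ∀ x y, inner ℂ (e x) (ι y) = inner ℂ (ι x) (e y))
    {c C : ℝ} (hc0 : 0 ≤ c) (hC0 : 0 ≤ C) (hc : ∀ x, ‖ι x‖ ≤ c * ‖e x‖)
    (hC : ∀ x, ‖a x‖ ^ 2 ≤ C * (inner ℂ (ι x) (e x)).re) :
    ∃ M, (∀ y, ‖ι (e'.symm y)‖ ≤ M * ‖y‖) ∧ (∀ y, ‖a (e'.symm y)‖ ≤ M * ‖y‖) ∧
      (∀ v : V, ‖ι (e'.symm (s v))‖ ≤ M * ‖v‖) ∧ (∀ v : V, ‖a (e'.symm (s v))‖ ≤ M * ‖v‖) := by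
  obtain ⟨K, hK0, hK⟩ := exists_norm_le_of_shift ι e e' d hd hc
  set c' := Real.sqrt (C * c) with hc'
  have hc'0 : 0 ≤ c' := Real.sqrt_nonneg _
  have ha : ∀ x, ‖a x‖ ≤ c' * ‖e x‖ := by
    intro x
    refine abs_le_of_sq_le_sq' ?_ (by positivity) |>.2
    rw [mul_pow, hc', Real.sq_sqrt (by positivity)]
    calc ‖a x‖ ^ 2 ≤ C * (inner ℂ (ι x) (e x)).re := hC x
      _ ≤ C * ((c * ‖e x‖) * ‖e x‖) := by
        gcongr
        exact (re_inner_le_norm (𝕜 := ℂ) _ _).trans (by gcongr; exact hc x)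
      _ = _ := by ring
  have hι' : ∀ y, ‖ι (e'.symm y)‖ ≤ (c * K) * ‖y‖ := fun y => by
    have := hK (e'.symm y)
    rw [e'.apply_symm_apply] at this
    calc _ ≤ c * ‖e (e'.symm y)‖ := hc _
      _ ≤ c * (K * ‖y‖) := by gcongr
      _ = _ := by ring
  have ha' : ∀ y, ‖a (e'.symm y)‖ ≤ (c' * K) * ‖y‖ := fun y => by
    have := hK (e'.symm y)
    rw [e'.apply_symm_apply] at this
    calc _ ≤ c' * ‖e (e'.symm y)‖ := ha _
      _ ≤ c' * (K * ‖y‖) := by gcongr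
      _ = _ := by ring
  -- Duality: `e⁻¹ s` is formally adjoint to `a e⁻¹`, so the test vector `g = e⁻¹ (ι f)` transfers
  -- the bound `ha`.
  have hιs : ∀ v : V, ‖ι (e.symm (s v))‖ ≤ c' * ‖v‖ := by
    intro v
    set f := e.symm (s v) with hf
    set g := e.symm (ι f) with hg
    have h1 : ‖ι f‖ ^ 2 ≤ ‖v‖ * (c' * ‖ι f‖) := by
      calc ‖ι f‖ ^ 2 = (inner ℂ (ι f) (ι f)).re := (inner_self_eq_norm_sq (𝕜 := ℂ) _).symm
        _ = (inner ℂ (v : X) (a g)).re := by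
          rw [← hadj]
          have hgf : ι f = e g := (e.apply_symm_apply _).symm
          have hfv : s v = e f := (e.apply_symm_apply _).symm
          rw [hfv, hsym, ← hgf]
        _ ≤ ‖(v : X)‖ * ‖a g‖ := re_inner_le_norm (𝕜 := ℂ) _ _
        _ ≤ ‖v‖ * (c' * ‖ι f‖) := by
          gcongr
          · exact le_rfl
          · simpa [hg] using ha g
    by_cases h0 : ‖ι f‖ = 0
    · rw [h0]; positivity
    · exact le_of_mul_le_mul_right (by linarith : ‖ι f‖ * ‖ι f‖ ≤ c' * ‖v‖ * ‖ι f‖)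
        (lt_of_le_of_ne (norm_nonneg _) (Ne.symm h0))
  -- The energy of `f = e⁻¹ (s v)` is `(v, a f)`, so the form bound leaves one factor `‖a f‖` to
  -- cancel.
  have has : ∀ v : V, ‖a (e.symm (s v))‖ ≤ C * ‖v‖ := by
    intro v
    set f := e.symm (s v) with hf
    have h1 : ‖a f‖ ^ 2 ≤ C * (‖v‖ * ‖a f‖) := by
      refine (hC f).trans ?_
      gcongr
      rw [← hsym, hf, e.apply_symm_apply, ← hf, hadj]
      exact re_inner_le_norm (𝕜 := ℂ) _ _
    by_cases h0 : ‖a f‖ = 0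
    · rw [h0]; positivity
    · exact le_of_mul_le_mul_right (by linarith : ‖a f‖ * ‖a f‖ ≤ C * ‖v‖ * ‖a f‖)
        (lt_of_le_of_ne (norm_nonneg _) (Ne.symm h0))
  -- First resolvent identity, with `e'⁻¹` outermost so that only `ι e⁻¹ s` and maps already bounded
  -- on all of `𝓗` occur in the correction.
  have hres : ∀ y, e'.symm y = e.symm y - d • e'.symm (ι (e.symm y)) := fun y => by
    apply e'.injective
    rw [map_sub, map_smul, e'.apply_symm_apply, e'.apply_symm_apply, hd, e.apply_symm_apply]
    abel
  refine ⟨max (max (c * K) (c' * K)) (max (c' + ‖d‖ * ((c * K) * c'))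
    (C + ‖d‖ * ((c' * K) * c'))), fun y => (hι' y).trans ?_, fun y => (ha' y).trans ?_,
    fun v => ?_, fun v => ?_⟩
  · gcongr; simp
  · gcongr; simp
  · calc ‖ι (e'.symm (s v))‖ ≤ ‖ι (e.symm (s v))‖ + ‖d • ι (e'.symm (ι (e.symm (s v))))‖ := by
          rw [hres, map_sub, map_smul]; exact norm_sub_le _ _
      _ ≤ c' * ‖v‖ + ‖d‖ * ((c * K) * (c' * ‖v‖)) := by
          rw [norm_smul]
          gcongr
          · exact hιs v
          · exact (hι' _).trans (by gcongr; exact hιs v)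
      _ = (c' + ‖d‖ * ((c * K) * c')) * ‖v‖ := by ring
      _ ≤ _ := by gcongr; simp
  · calc ‖a (e'.symm (s v))‖ ≤ ‖a (e.symm (s v))‖ + ‖d • a (e'.symm (ι (e.symm (s v))))‖ := by
          rw [hres, map_sub, map_smul]; exact norm_sub_le _ _
      _ ≤ C * ‖v‖ + ‖d‖ * ((c' * K) * (c' * ‖v‖)) := by
          rw [norm_smul]
          gcongr
          · exact has v
          · exact (ha' _).trans (by gcongr; exact hιs v)
      _ = (C + ‖d‖ * ((c' * K) * c')) * ‖v‖ := by ring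
      _ ≤ _ := by gcongr; simp

omit [CompleteSpace X] in
/-- A bounded linear map on a dense subspace extends to the whole space. -/
theorem exists_extension {Y : Type*} [NormedAddCommGroup Y] [NormedSpace ℂ Y] [CompleteSpace Y]
    (hV : Dense (V : Set X)) (f : V →ₗ[ℂ] Y) {M : ℝ} (hM : ∀ v, ‖f v‖ ≤ M * ‖v‖) :
    ∃ F : X →L[ℂ] Y, ∀ v : V, F v = f v :=
  ⟨(f.mkContinuous M hM).extend V.subtypeL, fun v =>
    ContinuousLinearMap.extend_eq _ hV.denseRange_val
      isUniformEmbedding_subtype_val.isUniformInducing v⟩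

end Core

/-! ### The formula under form bounds -/

section Core

variable {𝓗 X D : Type*} [NormedAddCommGroup 𝓗] [InnerProductSpace ℂ 𝓗] [CompleteSpace 𝓗]
  [NormedAddCommGroup X] [InnerProductSpace ℂ X] [CompleteSpace X]
  [AddCommGroup D] [Module ℂ D] {V : Submodule ℂ X}

/-- The Konno–Kuroda formula for linear maps on a common domain `D`: here `ι` is the inclusion,
`e₀ = H₀ + l`, `e₁ = H + l` and `e = H₀ + z`, with `l` in both resolvent sets. -/
theorem konnoKuroda_of_form_bound (ι : D →ₗ[ℂ] 𝓗) (a : D →ₗ[ℂ] X) (s : V →ₗ[ℂ] 𝓗)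
    (hV : Dense (V : Set X)) (J : X →L[ℂ] X) (b : D →ₗ[ℂ] V) (hb : ∀ x, (b x : X) = J (a x))
    (hadj : ∀ v x, inner ℂ (s v) (ι x) = inner ℂ (v : X) (a x))
    (e₀ e₁ e : D ≃ₗ[ℂ] 𝓗) (h₁ : ∀ x, e₁ x = e₀ x - s (b x)) (d : ℂ)
    (hd : ∀ x, e x = e₀ x + d • ι x)
    (hsym₀ : ∀ x y, inner ℂ (e₀ x) (ι y) = inner ℂ (ι x) (e₀ y))
    (hsym₁ : ∀ x y, inner ℂ (e₁ x) (ι y) = inner ℂ (ι x) (e₁ y))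
    {c C : ℝ} (hc0 : 0 ≤ c) (hC0 : 0 ≤ C) (hι₀ : ∀ x, ‖ι x‖ ≤ c * ‖e₀ x‖)
    (hι₁ : ∀ x, ‖ι x‖ ≤ c * ‖e₁ x‖)
    (ha₀ : ∀ x, ‖a x‖ ^ 2 ≤ C * (inner ℂ (ι x) (e₀ x)).re)
    (ha₁ : ∀ x, ‖a x‖ ^ 2 ≤ C * (inner ℂ (ι x) (e₁ x)).re) :
    ∃ Φ : X →L[ℂ] X, (∀ v : V, Φ v = J (a (e.symm (s v)))) ∧
      (IsUnit (1 - Φ) ↔ Function.Bijective (e.toLinearMap - s ∘ₗ b)) ∧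
      (IsUnit (1 - Φ) →
        (∀ x, Ring.inverse (1 - Φ) (b (e.symm (e x - s (b x)))) = b x) ∧
        ∀ (v : V) x, e x - s (b x) = s v → Ring.inverse (1 - Φ) (v : X) = v + b x) := by
  obtain ⟨M, hM1, hM2, hM3, hM4⟩ :=
    exists_bound_of_form_bound ι a s hadj e₀ e d hd hsym₀ hc0 hC0 hι₀ ha₀
  obtain ⟨M', hM1', hM2', hM3', hM4'⟩ :=
    exists_bound_of_form_bound ι a s hadj e₁ e₁ 0 (by simp) hsym₁ hc0 hC0 hι₁ ha₁
  obtain ⟨Q, hQ⟩ := exists_extension hV (ι ∘ₗ e.symm.toLinearMap ∘ₗ s) hM3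
  obtain ⟨F, hF⟩ := exists_extension hV (a ∘ₗ e.symm.toLinearMap ∘ₗ s) hM4
  obtain ⟨F₁, hF₁⟩ := exists_extension hV (a ∘ₗ e₁.symm.toLinearMap ∘ₗ s) hM4'
  obtain ⟨Q₁, hQ₁⟩ := exists_extension hV (ι ∘ₗ e₁.symm.toLinearMap ∘ₗ s) hM3'
  set P₁ : 𝓗 →L[ℂ] 𝓗 := (ι ∘ₗ e₁.symm.toLinearMap).mkContinuous M' hM1' with hP₁
  set A₁ : 𝓗 →L[ℂ] X := (a ∘ₗ e₁.symm.toLinearMap).mkContinuous M' hM2' with hA₁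
  have hP₁a : ∀ y, P₁ y = ι (e₁.symm y) := fun y => rfl
  have hA₁a : ∀ y, A₁ y = a (e₁.symm y) := fun y => rfl
  simp only [LinearMap.comp_apply, LinearEquiv.coe_coe] at hQ hF hF₁ hQ₁
  set Φ : X →L[ℂ] X := J ∘L F with hΦ
  have hΦv : ∀ v : V, Φ v = b (e.symm (s v)) := fun v => by simp [hΦ, hF, hb]
  have hex : ∀ x, e x - s (b x) = e₁ x + d • ι x := fun x => by rw [hd, h₁]; abel
  -- The identity `(1 - φ(z)) B = B R₀(z) (H + z)` on `D`.
  have hform : ∀ x, (1 - Φ) (b x : X) = b (e.symm (e x - s (b x))) := fun x => by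
    simp [hΦv]
  have huniq : ∀ (v : V) x, e x - s (b x) = s v → (1 - Φ) ((v : X) + b x) = v := by
    intro v x hx
    rw [map_add, hform, hx]
    simp [hΦv]
  refine ⟨Φ, fun v => by simp [hΦ, hF], ⟨?_, ?_⟩, ?_⟩
  · intro hU
    have hinj : Function.Injective (1 - Φ : X →L[ℂ] X) := (ContinuousLinearMap.isUnit_iff_bijective.1 hU).1
    constructor
    · rw [← LinearMap.ker_eq_bot, LinearMap.ker_eq_bot']
      intro x hx
      replace hx : e x - s (b x) = 0 := hx
      have h0 : (b x : X) = 0 := hinj (by rw [hform, hx]; simp)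
      rw [Submodule.coe_eq_zero.1 h0, map_zero, sub_zero] at hx
      simpa using hx
    · intro y
      obtain ⟨u, hu⟩ := (ContinuousLinearMap.isUnit_iff_bijective.1 hU).2 (b (e.symm y))
      -- `f u` is the candidate solution of `(H + z) f = y`, and `r` is the defect of `(1 - Φ) v = B
      -- R₀(z) y`, which vanishes at `u`.
      set f : X → 𝓗 := fun v => ι (e.symm y) + Q v with hf
      set r : X → X := fun v => v - b (e.symm y) - Φ v with hr
      -- On `V` everything lies in `D`, so `H + l` can be applied: the defect appears behind `(H +
      -- l)⁻¹ A*`, which is bounded, and the identity extends to `u`.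
      have key : ∀ v : V, e.symm y + e.symm (s v) =
          e₁.symm (y - d • f v) + e₁.symm (s (v - b (e.symm y) - b (e.symm (s v)))) := by
        intro v
        apply e₁.injective
        have e1 : ∀ x, e₁ x = e x - s (b x) - d • ι x := fun x => by rw [hex]; abel
        rw [map_add e₁, map_add e₁, e1, e1]
        simp only [e₁.apply_symm_apply, e.apply_symm_apply, map_sub, hf, hQ, smul_add]
        abel
      have hfc : Continuous f := by fun_prop
      have hrc : Continuous r := by fun_prop
      have rv : ∀ v : V, r v = ((v - b (e.symm y) - b (e.symm (s v)) : V) : X) := fun v => by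
        simp [hr, hΦv]
      have k1 : f = fun v => P₁ (y - d • f v) + Q₁ (r v) := by
        refine Continuous.ext_on hV hfc (by fun_prop) fun v hv => ?_
        have := congrArg ι (key ⟨v, hv⟩)
        have h2 := rv ⟨v, hv⟩
        simp only [map_add ι] at this
        simp only at h2 this ⊢
        rw [h2, hQ₁, hP₁a, ← this]
        simp only [hf]
        rw [hQ ⟨v, hv⟩]
      have k2 : (fun v => a (e.symm y) + F v) = fun v => A₁ (y - d • f v) + F₁ (r v) := by
        refine Continuous.ext_on hV (by fun_prop) (by fun_prop) fun v hv => ?_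
        have := congrArg a (key ⟨v, hv⟩)
        have h2 := rv ⟨v, hv⟩
        simp only [map_add a] at this
        simp only at h2 this ⊢
        rw [h2, hF₁, hA₁a, ← this, hF ⟨v, hv⟩]
      have ru : r u = 0 := by
        rw [hr]
        simp only [← hu]
        simp
      have k1u := congrFun k1 u
      have k2u := congrFun k2 u
      simp only [ru, map_zero, add_zero, hP₁a, hA₁a] at k1u k2u
      -- Now `f u = (H + l)⁻¹ (y - d f u)`, so it lies in `D` and satisfies `(H + z) f u = y`.
      refine ⟨e₁.symm (y - d • f u), ?_⟩
      change e _ - s (b _) = y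
      rw [hex, e₁.apply_symm_apply, ← k1u]
      abel
  · intro hB
    set e' : D ≃ₗ[ℂ] 𝓗 := LinearEquiv.ofBijective _ hB with he'
    have he'a : ∀ x, e' x = e x - s (b x) := fun x => rfl
    obtain ⟨M₂, -, -, -, hM₂⟩ := exists_bound_of_form_bound ι a s hadj e₁ e' d
      (fun x => by rw [he'a, hex]) hsym₁ hc0 hC0 hι₁ ha₁
    obtain ⟨F₂, hF₂⟩ := exists_extension hV (a ∘ₗ e'.symm.toLinearMap ∘ₗ s) hM₂
    simp only [LinearMap.comp_apply, LinearEquiv.coe_coe] at hF₂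
    set Ψ : X →L[ℂ] X := 1 + J ∘L F₂ with hΨ
    have hΨv : ∀ v : V, Ψ v = v + b (e'.symm (s v)) := fun v => by simp [hΨ, hF₂, hb]
    have l : (1 - Φ) * Ψ = 1 := by
      refine ContinuousLinearMap.coeFn_injective
        (Continuous.ext_on hV (by fun_prop) (by fun_prop) fun v hv => ?_)
      rw [mul_apply_eq_comp, hΨv ⟨v, hv⟩]
      exact huniq ⟨v, hv⟩ _ (by rw [← he'a, e'.apply_symm_apply])
    have r : Ψ * (1 - Φ) = 1 := by
      refine ContinuousLinearMap.coeFn_injective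
        (Continuous.ext_on hV (by fun_prop) (by fun_prop) fun v hv => ?_)
      set x := e.symm (s ⟨v, hv⟩) with hx
      have h1 : (1 - Φ) v = ((⟨v, hv⟩ - b x : V) : X) := by
        simp [hx, hΦv ⟨v, hv⟩]
      have h2 : e'.symm (s (⟨v, hv⟩ - b x)) = x := by
        rw [LinearEquiv.symm_apply_eq, he'a, hx, e.apply_symm_apply, map_sub]
      rw [mul_apply_eq_comp, h1, hΨv, h2]
      simp
    exact ⟨⟨1 - Φ, Ψ, l, r⟩, rfl⟩
  · intro hU
    have hi : ∀ u, Ring.inverse (1 - Φ) ((1 - Φ) u) = u := fun u => by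
      rw [← mul_apply_eq_comp, Ring.inverse_mul_cancel _ hU]; rfl
    refine ⟨fun x => by rw [← hform, hi], fun v x hx => ?_⟩
    conv_lhs => rw [← huniq v x hx]
    rw [hi]

end Core

/-! ### From relative bounds to form bounds -/

section Core

variable {𝓗 X D : Type*} [NormedAddCommGroup 𝓗] [InnerProductSpace ℂ 𝓗]
  [NormedAddCommGroup X] [InnerProductSpace ℂ X]
  [AddCommGroup D] [Module ℂ D] {V : Submodule ℂ X}

theorem norm_le_norm_add_smul_of_re_inner_nonneg {x y : 𝓗} (h : 0 ≤ (inner ℂ x y).re) {l : ℝ}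
    (hl : 0 ≤ l) : ‖y‖ ≤ ‖y + (l : ℂ) • x‖ ∧ l * ‖x‖ ≤ ‖y + (l : ℂ) • x‖ := by
  have key : ‖y + (l : ℂ) • x‖ ^ 2 = ‖y‖ ^ 2 + 2 * (l * (inner ℂ x y).re) + (l * ‖x‖) ^ 2 := by
    have := norm_add_sq (𝕜 := ℂ) y ((l : ℂ) • x)
    have hre : RCLike.re (inner ℂ y ((l : ℂ) • x)) = l * (inner ℂ x y).re := by
      rw [inner_smul_right, ← inner_conj_symm]
      simp only [RCLike.re_to_complex, Complex.re_ofReal_mul, Complex.conj_re]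
    rw [this, hre, norm_smul, Complex.norm_real, Real.norm_of_nonneg hl]
  have h1 := mul_nonneg hl h
  constructor <;> refine abs_le_of_sq_le_sq' ?_ (norm_nonneg _) |>.2 <;> rw [key]
  · nlinarith [sq_nonneg (l * ‖x‖)]
  · nlinarith [sq_nonneg ‖y‖]

/-- The Konno–Kuroda formula for linear maps on a common domain `D`, with the hypotheses in terms of
relative boundedness. -/
theorem konnoKuroda_of_relBound [CompleteSpace 𝓗] [CompleteSpace X]
    (ι h : D →ₗ[ℂ] 𝓗) (a : D →ₗ[ℂ] X) (s : V →ₗ[ℂ] 𝓗)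
    (hV : Dense (V : Set X)) (J : X →L[ℂ] X) (hJ : IsSelfAdjoint J)
    (b : D →ₗ[ℂ] V) (hb : ∀ x, (b x : X) = J (a x))
    (t : D →ₗ[ℂ] V) (ht : ∀ x, (t x : X) = a x)
    (hadj : ∀ v x, inner ℂ (s v) (ι x) = inner ℂ (v : X) (a x))
    (hsym : ∀ x y, inner ℂ (h x) (ι y) = inner ℂ (ι x) (h y))
    (hpos : ∀ x, 0 ≤ (inner ℂ (ι x) (h x)).re)
    (hbij : ∀ l : ℝ, 0 < l → Function.Bijective (h + (l : ℂ) • ι))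
    {α β α' β' : ℝ} (hα : 0 ≤ α) (hα1 : α < 1) (hβ : 0 ≤ β)
    (hw : ∀ x, ‖s (b x)‖ ≤ α * ‖h x‖ + β * ‖ι x‖) (hα' : 0 ≤ α') (hβ' : 0 ≤ β')
    (ht' : ∀ x, ‖s (t x)‖ ≤ α' * ‖h x‖ + β' * ‖ι x‖)
    (z : ℂ) (e : D ≃ₗ[ℂ] 𝓗) (he : ∀ x, e x = h x + z • ι x) :
    ∃ Φ : X →L[ℂ] X, (∀ v : V, Φ v = J (a (e.symm (s v)))) ∧
      (IsUnit (1 - Φ) ↔ Function.Bijective (e.toLinearMap - s ∘ₗ b)) ∧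
      (IsUnit (1 - Φ) →
        (∀ x, Ring.inverse (1 - Φ) (b (e.symm (e x - s (b x)))) = b x) ∧
        ∀ (v : V) x, e x - s (b x) = s v → Ring.inverse (1 - Φ) (v : X) = v + b x) := by
  have h1α : 0 < 1 - α := sub_pos.2 hα1
  -- This `l` gives `α + β / l ≤ (1 + α) / 2 = q < 1`.
  obtain ⟨l, hl, hβl⟩ : ∃ l : ℝ, 0 < l ∧ β ≤ (1 - α) / 2 * l := by
    refine ⟨2 * β / (1 - α) + 1, by positivity, ?_⟩
    have : (1 - α) / 2 * (2 * β / (1 - α) + 1) = β + (1 - α) / 2 := by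
      field_simp
    rw [this]
    linarith
  set q := (1 + α) / 2 with hq
  have hq0 : 0 ≤ q := by positivity
  have hq1 : q < 1 := by linarith
  have h1q : 0 < 1 - q := sub_pos.2 hq1
  set e₀ : D ≃ₗ[ℂ] 𝓗 := LinearEquiv.ofBijective _ (hbij l hl)
  have e₀a : ∀ x, e₀ x = h x + (l : ℂ) • ι x := fun x => rfl
  have hn : ∀ x, ‖h x‖ ≤ ‖e₀ x‖ ∧ l * ‖ι x‖ ≤ ‖e₀ x‖ := fun x =>
    norm_le_norm_add_smul_of_re_inner_nonneg (hpos x) hl.le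
  have hι : ∀ x, ‖ι x‖ ≤ l⁻¹ * ‖e₀ x‖ := fun x => by
    rw [inv_mul_eq_div, le_div_iff₀' hl]; exact (hn x).2
  have hwq : ∀ x, ‖s (b x)‖ ≤ q * ‖e₀ x‖ := fun x =>
    calc ‖s (b x)‖ ≤ α * ‖h x‖ + β * ‖ι x‖ := hw x
      _ ≤ α * ‖h x‖ + (1 - α) / 2 * l * ‖ι x‖ := by gcongr
      _ = α * ‖h x‖ + (1 - α) / 2 * (l * ‖ι x‖) := by ring
      _ ≤ α * ‖e₀ x‖ + (1 - α) / 2 * ‖e₀ x‖ := by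
        gcongr
        · exact (hn x).1
        · exact (hn x).2
      _ = q * ‖e₀ x‖ := by rw [hq]; ring
  set C := α' + β' * l⁻¹ with hC
  have hC0 : 0 ≤ C := by positivity
  have htC : ∀ x, ‖s (t x)‖ ≤ C * ‖e₀ x‖ := fun x =>
    calc ‖s (t x)‖ ≤ α' * ‖h x‖ + β' * ‖ι x‖ := ht' x
      _ ≤ α' * ‖e₀ x‖ + β' * (l⁻¹ * ‖e₀ x‖) := by
        gcongr
        · exact (hn x).1
        · exact hι x
      _ = C * ‖e₀ x‖ := by rw [hC]; ring
  set e₁ : D ≃ₗ[ℂ] 𝓗 := LinearEquiv.ofBijective _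
    (bijective_sub_of_le e₀ (s ∘ₗ b) hq1 hq0 hwq)
  have e₁a : ∀ x, e₁ x = e₀ x - s (b x) := fun x => rfl
  have hadj' : ∀ x v, inner ℂ (ι x) (s v) = inner ℂ (a x) (v : X) := fun x v => by
    rw [← inner_conj_symm, hadj, inner_conj_symm]
  have hsymw : ∀ x y, inner ℂ (s (b x)) (ι y) = inner ℂ (ι x) (s (b y)) := fun x y => by
    rw [hadj, hadj', hb, hb]
    exact hJ.isSymmetric _ _
  have hsymt : ∀ x y, inner ℂ (s (t x)) (ι y) = inner ℂ (ι x) (s (t y)) := fun x y => by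
    rw [hadj, hadj', ht, ht]
  have hsym₀ : ∀ x y, inner ℂ (e₀ x) (ι y) = inner ℂ (ι x) (e₀ y) := fun x y => by
    simp [e₀a, hsym]
  have hsym₁ : ∀ x y, inner ℂ (e₁ x) (ι y) = inner ℂ (ι x) (e₁ y) := fun x y => by
    simp [e₁a, hsym₀, hsymw]
  have hpos₀ : ∀ x, 0 ≤ (inner ℂ (ι x) (e₀ x)).re := fun x => by
    rw [e₀a, inner_add_right, inner_smul_right, Complex.add_re, Complex.re_ofReal_mul]
    exact add_nonneg (hpos x) (mul_nonneg hl.le (inner_self_nonneg (𝕜 := ℂ)))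
  have ha₀ : ∀ x, ‖a x‖ ^ 2 ≤ C * (inner ℂ (ι x) (e₀ x)).re := fun x => by
    refine le_trans ?_ (abs_re_inner_le ι (s ∘ₗ t) e₀ hsym₀ hpos₀ hsymt hC0 htC hι x)
    refine le_trans (le_of_eq ?_) (le_abs_self _)
    rw [LinearMap.comp_apply, hadj', ht]
    exact (inner_self_eq_norm_sq (𝕜 := ℂ) _).symm
  have hform₁ : ∀ x, (1 - q) * (inner ℂ (ι x) (e₀ x)).re ≤ (inner ℂ (ι x) (e₁ x)).re :=
    fun x => by
      have := (le_abs_self _).trans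
        (abs_re_inner_le ι (s ∘ₗ b) e₀ hsym₀ hpos₀ hsymw hq0 hwq hι x)
      rw [LinearMap.comp_apply] at this
      rw [e₁a, inner_sub_right, Complex.sub_re]
      linarith
  have hnorm₁ : ∀ x, (1 - q) * ‖e₀ x‖ ≤ ‖e₁ x‖ := fun x => by
    have := norm_sub_norm_le (e₀ x) (s (b x))
    rw [e₁a]
    linarith [hwq x]
  have hle : (1 : ℝ) ≤ (1 - q)⁻¹ := (one_le_inv₀ h1q).2 (by linarith)
  -- The factor `(1 - q)⁻¹` is the price of passing from `e₀` to `e₁`; being at least one, it lets a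
  -- single pair of constants serve both.
  refine konnoKuroda_of_form_bound ι a s hV J b hb hadj e₀ e₁ e e₁a (z - l)
    (fun x => by rw [he, e₀a, sub_smul]; abel) hsym₀ hsym₁ (c := l⁻¹ * (1 - q)⁻¹)
    (C := C * (1 - q)⁻¹) (by positivity) (by positivity) (fun x => ?_) (fun x => ?_)
    (fun x => ?_) (fun x => ?_)
  · exact (hι x).trans (by gcongr; exact le_mul_of_one_le_right (by positivity) hle)
  · refine (hι x).trans ?_
    rw [mul_assoc]
    gcongr
    rw [inv_mul_eq_div, le_div_iff₀' h1q]
    exact hnorm₁ x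
  · refine (ha₀ x).trans (mul_le_mul_of_nonneg_right ?_ (hpos₀ x))
    exact le_mul_of_one_le_right hC0 hle
  · refine (ha₀ x).trans ?_
    rw [mul_assoc]
    gcongr
    rw [inv_mul_eq_div, le_div_iff₀' h1q]
    exact hform₁ x

end Core

/-! ### Adjoints and self-adjoint operators -/

section LinearPMap

variable {E F : Type*} [NormedAddCommGroup E] [InnerProductSpace ℂ E] [CompleteSpace E]
  [NormedAddCommGroup F] [InnerProductSpace ℂ F] [CompleteSpace F]

/-- The adjoint of a closed densely defined operator is densely defined. -/
theorem dense_adjoint_domain (A : E →ₗ.[ℂ] F) (hA : A.IsClosed) :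
    Dense (A†.domain : Set F) := by
  rw [Submodule.dense_iff_topologicalClosure_eq_top, Submodule.topologicalClosure_eq_top_iff,
    Submodule.eq_bot_iff]
  intro v hv
  set G : Submodule ℂ (WithLp 2 (E × F)) :=
    A.graph.comap (WithLp.linearEquiv 2 ℂ (E × F)).toLinearMap with hG
  have hGc : IsClosed (G : Set (WithLp 2 (E × F))) :=
    IsClosed.preimage (WithLp.prod_continuous_ofLp 2 E F) hA
  -- Orthogonality of `w` to the graph says `A* w.snd = -w.fst`, so `v ⊥ D(A*)` puts `(0, v)` in the
  -- double complement, the closed graph itself.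
  have hmem : WithLp.toLp 2 ((0 : E), v) ∈ Gᗮᗮ := by
    rw [Submodule.mem_orthogonal]
    intro w hw
    rw [Submodule.mem_orthogonal'] at hw
    have hd : w.snd ∈ A†.domain := by
      refine LinearPMap.mem_adjoint_domain_of_exists _ ⟨-w.fst, fun x => ?_⟩
      have := hw (WithLp.toLp 2 ((x : E), A x)) (A.mem_graph x)
      rw [WithLp.prod_inner_apply] at this
      simp only at this
      rw [inner_neg_left]
      exact neg_eq_of_add_eq_zero_right this
    rw [WithLp.prod_inner_apply]
    simpa using hv _ hd
  rw [Submodule.orthogonal_orthogonal_eq_closure, hGc.submodule_topologicalClosure_eq] at hmem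
  exact A.graph_fst_eq_zero_snd hmem rfl

/-- A nonnegative self-adjoint operator has `(0, ∞)` in its resolvent set (in the convention
`H + l`). -/
theorem ofReal_mem_rho (H : E →ₗ.[ℂ] E) (hH : IsSelfAdjoint H)
    (hpos : ∀ x : H.domain, 0 ≤ (inner ℂ (x : E) (H x)).re) {l : ℝ} (hl : 0 < l) :
    (l : ℂ) ∈ rho H := by
  have hn := fun x : H.domain => norm_le_norm_add_smul_of_re_inner_nonneg (hpos x) hl.le
  have hfa : H.IsFormalAdjoint H := by
    have := LinearPMap.adjoint_isFormalAdjoint hH.dense_domain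
    rwa [LinearPMap.isSelfAdjoint_def.1 hH] at this
  set S : H.domain →ₗ[ℂ] E := (shift H l).toFun with hS
  have hSa : ∀ x : H.domain, S x = H x + (l : ℂ) • (x : E) := fun x => add_comm _ _
  have hinj : Function.Injective S := by
    rw [← LinearMap.ker_eq_bot, LinearMap.ker_eq_bot']
    intro x hx
    have := (hn x).2
    rw [← hSa, hx, norm_zero] at this
    have h0 : ‖(x : E)‖ ≤ 0 := by nlinarith [norm_nonneg (x : E)]
    exact Subtype.ext (norm_le_zero_iff.1 h0)
  -- On the complete graph of `H`, the map `(x, H x) ↦ H x + l x` is bounded below, hence has closed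
  -- range.
  have hcl : IsClosed (LinearMap.range S : Set E) := by
    set T : H.graph →L[ℂ] E :=
      (ContinuousLinearMap.snd ℂ E E + (l : ℂ) • ContinuousLinearMap.fst ℂ E E) ∘L
        H.graph.subtypeL with hT
    have hbound : ∀ g, ‖g‖ ≤ ((max 1 l⁻¹).toNNReal : ℝ) * ‖T g‖ := by
      rintro ⟨g, hg⟩
      obtain ⟨x, rfl, rfl⟩ := LinearPMap.mem_graph_iff' H |>.1 hg
      rw [Real.coe_toNNReal _ (by positivity)]
      change max ‖(x : E)‖ ‖H x‖ ≤ _ * ‖H x + (l : ℂ) • (x : E)‖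
      refine max_le ?_ ?_
      · calc ‖(x : E)‖ ≤ l⁻¹ * ‖H x + (l : ℂ) • (x : E)‖ := by
              rw [inv_mul_eq_div, le_div_iff₀' hl]; exact (hn x).2
          _ ≤ _ := by gcongr; exact le_max_right _ _
      · exact (hn x).1.trans (le_mul_of_one_le_left (norm_nonneg _) (le_max_left _ _))
    have hGc : IsClosed (H.graph : Set (E × E)) := hH.isClosed
    have : CompleteSpace H.graph := hGc.completeSpace_coe
    have hr : (LinearMap.range S : Set E) = Set.range T := by
      ext y
      constructor
      · rintro ⟨x, rfl⟩
        exact ⟨⟨_, H.mem_graph x⟩, (hSa x).symm⟩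
      · rintro ⟨⟨g, hg⟩, rfl⟩
        obtain ⟨x, rfl, rfl⟩ := LinearPMap.mem_graph_iff' H |>.1 hg
        exact ⟨x, hSa x⟩
    rw [hr]
    exact (T.antilipschitz_of_bound hbound).isClosed_range T.uniformContinuous
  refine ⟨hinj, ?_⟩
  have : CompleteSpace (shift H l).toFun.range := hcl.completeSpace_coe
  refine LinearMap.range_eq_top.1 (Submodule.orthogonal_eq_bot_iff.1 ?_)
  rw [Submodule.eq_bot_iff]
  intro y hy
  rw [Submodule.mem_orthogonal'] at hy
  have hyx : ∀ x : H.domain, inner ℂ (-((l : ℂ) • y)) (x : E) = inner ℂ y (H x) := fun x => by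
    have := hy (S x) ⟨x, rfl⟩
    rw [hSa, inner_add_right, inner_smul_right] at this
    rw [inner_neg_left, inner_smul_left, Complex.conj_ofReal]
    linear_combination -this
  have hyd : y ∈ H†.domain := LinearPMap.mem_adjoint_domain_of_exists _ ⟨_, hyx⟩
  rw [LinearPMap.isSelfAdjoint_def.1 hH] at hyd
  -- A vector orthogonal to the range lies in `D(H†) = D(H)` and is killed by `H + l`, so
  -- injectivity finishes.
  have hHy : S ⟨y, hyd⟩ = 0 := by
    refine hH.dense_domain.eq_zero_of_inner_left ℂ fun x hx => ?_
    have := hyx ⟨x, hx⟩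
    rw [← hfa ⟨y, hyd⟩ ⟨x, hx⟩, inner_neg_left] at this
    rw [hSa, inner_add_left]
    linear_combination -this
  exact congrArg Subtype.val (hinj (hHy.trans (map_zero S).symm))

end LinearPMap

/-! ### Graph calculus for unbounded operators -/

section Graph

variable {E F G : Type*}
  [NormedAddCommGroup E] [InnerProductSpace ℂ E]
  [NormedAddCommGroup F] [InnerProductSpace ℂ F]
  [NormedAddCommGroup G] [InnerProductSpace ℂ G]

theorem mem_graph_iff_exists (T : E →ₗ.[ℂ] F) (x : E) (y : F) :
    (x, y) ∈ T.graph ↔ ∃ h : x ∈ T.domain, T ⟨x, h⟩ = y := by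
  rw [LinearPMap.mem_graph_iff]
  constructor
  · rintro ⟨⟨x', hx⟩, rfl, rfl⟩
    exact ⟨hx, rfl⟩
  · rintro ⟨hx, rfl⟩
    exact ⟨⟨x, hx⟩, rfl, rfl⟩

theorem mem_graph_pcomp (S : F →ₗ.[ℂ] G) (T : E →ₗ.[ℂ] F) (x : E) (y : G) :
    (x, y) ∈ (S ⊚ T).graph ↔ ∃ u, (x, u) ∈ T.graph ∧ (u, y) ∈ S.graph := by
  simp only [mem_graph_iff_exists]
  constructor
  · rintro ⟨hx, rfl⟩
    obtain ⟨h, h'⟩ := (mem_pcomp_domain S T x).1 hx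
    exact ⟨_, ⟨h, rfl⟩, h', rfl⟩
  · rintro ⟨_, ⟨h, rfl⟩, h', rfl⟩
    exact ⟨(mem_pcomp_domain S T x).2 ⟨h, h'⟩, rfl⟩

theorem mem_graph_full (T : E →L[ℂ] F) (x : E) (y : F) :
    (x, y) ∈ (full T).graph ↔ T x = y := by
  rw [mem_graph_iff_exists]
  exact ⟨fun ⟨_, h⟩ => h, fun h => ⟨trivial, h⟩⟩

theorem mem_graph_add (S T : E →ₗ.[ℂ] F) (x : E) (y : F) :
    (x, y) ∈ (S + T).graph ↔ ∃ u v, (x, u) ∈ S.graph ∧ (x, v) ∈ T.graph ∧ u + v = y := by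
  simp only [mem_graph_iff_exists]
  constructor
  · rintro ⟨⟨h, h'⟩, rfl⟩
    exact ⟨_, _, ⟨h, rfl⟩, ⟨h', rfl⟩, rfl⟩
  · rintro ⟨_, _, ⟨h, rfl⟩, ⟨h', rfl⟩, rfl⟩
    exact ⟨⟨h, h'⟩, rfl⟩

theorem mem_graph_res (T : E →ₗ.[ℂ] E) {z : ℂ} (hz : z ∈ rho T) (x y : E) :
    (y, x) ∈ (res T z).graph ↔ ∃ h : x ∈ T.domain, shift T z ⟨x, h⟩ = y := by
  have hker : LinearMap.ker (shift T z).toFun = ⊥ := LinearMap.ker_eq_bot.2 hz.1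
  refine Iff.trans ?_ (mem_graph_iff_exists (shift T z) x y)
  rw [res, LinearPMap.inverse_graph hker]
  simp

theorem res_domain (T : E →ₗ.[ℂ] E) {z : ℂ} (hz : z ∈ rho T) : (res T z).domain = ⊤ := by
  rw [res, LinearPMap.inverse_domain]
  exact LinearMap.range_eq_top.2 hz.2

/-- With this, each operator identity needs one pointwise computation and one comparison of domains.
-/
theorem eq_of_graph_le {S T : E →ₗ.[ℂ] F} (h : ∀ x y, (x, y) ∈ S.graph → (x, y) ∈ T.graph)
    (hd : T.domain ≤ S.domain) : S = T := by
  have hle : S ≤ T := LinearPMap.le_of_le_graph fun p hp => h p.1 p.2 hp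
  exact LinearPMap.eq_of_le_of_domain_eq hle (le_antisymm hle.1 hd)

end Graph

theorem mem_graph_opB {E F : Type*} [NormedAddCommGroup E] [InnerProductSpace ℂ E]
    [NormedAddCommGroup F] [InnerProductSpace ℂ F] (A : E →ₗ.[ℂ] F) (J : F →L[ℂ] F) (x : E)
    (y : F) : (x, y) ∈ (opB A J).graph ↔ ∃ h : x ∈ A.domain, J (A ⟨x, h⟩) = y := by
  rw [opB, mem_graph_pcomp]
  simp only [mem_graph_iff_exists A, mem_graph_full]
  exact ⟨fun ⟨_, ⟨h, h'⟩, hy⟩ => ⟨h, h' ▸ hy⟩, fun ⟨h, hy⟩ => ⟨_, ⟨h, rfl⟩, hy⟩⟩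

end KonnoKuroda

/-- Here `Φ` is the unique bounded everywhere defined extension of `φ(z)`, and `1 - φ(z)`,
`(1 - φ(z))⁻¹` are read as the bounded operators `1 - Φ`, `(1 - Φ)⁻¹`. The resolvent formula is an
equality of operators on natural domains, the left-hand side being defined everywhere; the second
formula is an equality of operators on the dense domain `D(A*)`. -/
theorem theoremB1 {𝓗 X : Type*}
    [NormedAddCommGroup 𝓗] [InnerProductSpace ℂ 𝓗] [CompleteSpace 𝓗]
    [NormedAddCommGroup X] [InnerProductSpace ℂ X] [CompleteSpace X]
    (H₀ : 𝓗 →ₗ.[ℂ] 𝓗) (hH₀ : IsSelfAdjoint H₀)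
    (hH₀_nonneg : ∀ x : H₀.domain, 0 ≤ (inner ℂ (x : 𝓗) (H₀ x)).re)
    (A : 𝓗 →ₗ.[ℂ] X) (hA_dense : Dense (A.domain : Set 𝓗)) (hA_closed : A.IsClosed)
    (hA_dom : H₀.domain ≤ A.domain)
    (J : X →L[ℂ] X) (hJ_sa : IsSelfAdjoint J) (hJ_isom : Isometry J)
    (hB_maps : ∀ x : (KonnoKuroda.opB A J).domain, (x : 𝓗) ∈ H₀.domain →
      KonnoKuroda.opB A J x ∈ A†.domain)
    (hAA : KonnoKuroda.RelBoundLTOne (KonnoKuroda.pcomp A† A) H₀)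
    (hAB : KonnoKuroda.RelBoundLTOne (KonnoKuroda.pcomp A† (KonnoKuroda.opB A J)) H₀)
    (z : ℂ) (hz : z ∈ KonnoKuroda.rho H₀) :
    (KonnoKuroda.phi H₀ A J z).domain = A†.domain ∧
    ∃ Φ : X →L[ℂ] X,
      KonnoKuroda.phi H₀ A J z ≤ KonnoKuroda.full Φ ∧
      (∀ Ψ : X →L[ℂ] X, KonnoKuroda.phi H₀ A J z ≤ KonnoKuroda.full Ψ → Ψ = Φ) ∧
      (IsUnit (1 - Φ) ↔
        z ∈ KonnoKuroda.rho H₀ ∩ KonnoKuroda.rho (KonnoKuroda.ham H₀ A J)) ∧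
      (IsUnit (1 - Φ) →
        KonnoKuroda.res (KonnoKuroda.ham H₀ A J) z =
          KonnoKuroda.res H₀ z +
            KonnoKuroda.res H₀ z ⊚ A† ⊚ KonnoKuroda.full (Ring.inverse (1 - Φ)) ⊚
              KonnoKuroda.opB A J ⊚ KonnoKuroda.res H₀ z ∧
        (Ring.inverse (1 - Φ)).toLinearMap.toPMap A†.domain =
          KonnoKuroda.full 1 +
            KonnoKuroda.opB A J ⊚ KonnoKuroda.res (KonnoKuroda.ham H₀ A J) z ⊚ A†) := by
  open KonnoKuroda in
  obtain ⟨hAAd, α', β', hα', -, hβ', ht'⟩ := hAA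
  obtain ⟨hABd, α, β, hα, hα1, hβ, hw⟩ := hAB
  have hBd : ∀ x ∈ H₀.domain, x ∈ (opB A J).domain := fun x hx =>
    ((mem_pcomp_domain _ _ _).1 (hABd hx)).1
  have hV := dense_adjoint_domain A hA_closed
  have hfaA := LinearPMap.adjoint_isFormalAdjoint hA_dense
  have hfa : H₀.IsFormalAdjoint H₀ := by
    have := LinearPMap.adjoint_isFormalAdjoint hH₀.dense_domain
    rwa [LinearPMap.isSelfAdjoint_def.1 hH₀] at this
  set a : H₀.domain →ₗ[ℂ] X := A.toFun ∘ₗ Submodule.inclusion hA_dom with ha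
  set b : H₀.domain →ₗ[ℂ] A†.domain := LinearMap.codRestrict _ (J.toLinearMap ∘ₗ a)
    (fun x => hB_maps ⟨x, hBd x x.2⟩ x.2) with hb
  set t : H₀.domain →ₗ[ℂ] A†.domain := LinearMap.codRestrict _ a
    (fun x => ((mem_pcomp_domain _ _ _).1 (hAAd x.2)).2) with ht
  set s : A†.domain →ₗ[ℂ] 𝓗 := A†.toFun with hs
  set e : H₀.domain ≃ₗ[ℂ] 𝓗 := LinearEquiv.ofBijective (shift H₀ z).toFun hz with he
  have hea : ∀ x : H₀.domain, e x = H₀ x + z • (x : 𝓗) := fun x => add_comm _ _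
  have hba : ∀ x, (b x : X) = J (a x) := fun x => rfl
  obtain ⟨Φ, hΦ, hunit, hform⟩ := konnoKuroda_of_relBound H₀.domain.subtype H₀.toFun a s hV J
    hJ_sa b hba t (fun x => rfl) (fun v x => hfaA v ⟨x, hA_dom x.2⟩) (fun x y => hfa x y) hH₀_nonneg
    (fun l hl => by
      have : ⇑(H₀.toFun + (l : ℂ) • H₀.domain.subtype) = shift H₀ l := by
        ext x; exact add_comm _ _
      rw [this]
      exact ofReal_mem_rho H₀ hH₀ hH₀_nonneg hl)
    hα hα1 hβ hw hα' hβ' ht' z e hea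
  have hR₀ : ∀ x y, (y, x) ∈ (res H₀ z).graph ↔ x = e.symm y := fun x y => by
    rw [mem_graph_res H₀ hz]
    constructor
    · rintro ⟨h, rfl⟩
      exact congrArg Subtype.val (e.symm_apply_apply ⟨x, h⟩).symm
    · rintro rfl
      exact ⟨(e.symm y).2, e.apply_symm_apply y⟩
  have hB : ∀ x : H₀.domain, ((x : 𝓗), (b x : X)) ∈ (opB A J).graph := fun x =>
    (mem_graph_opB A J _ _).2 ⟨hA_dom x.2, rfl⟩
  have hφ : ∀ v : A†.domain, ((v : X), Φ v) ∈ (phi H₀ A J z).graph := fun v => by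
    refine (mem_graph_pcomp _ _ _ _).2 ⟨e.symm (s v), (mem_graph_pcomp _ _ _ _).2
      ⟨s v, A†.mem_graph v, (hR₀ _ _).2 rfl⟩, ?_⟩
    rw [hΦ]
    exact hB _
  have hφd : (phi H₀ A J z).domain = A†.domain := by
    refine le_antisymm (fun x hx => ?_) fun x hx => ?_
    · exact ((mem_pcomp_domain _ _ _).1 ((mem_pcomp_domain _ _ _).1 hx).1).1
    · exact ((mem_graph_iff_exists _ _ _).1 (hφ ⟨x, hx⟩)).1
  have hφv : ∀ x : (phi H₀ A J z).domain, phi H₀ A J z x = Φ x := fun x => by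
    have hx : (x : X) ∈ A†.domain := hφd ▸ x.2
    obtain ⟨_, h⟩ := (mem_graph_iff_exists _ _ _).1 (hφ ⟨x, hx⟩)
    exact h
  have hdom : ∀ x, x ∈ H₀.domain ↔ x ∈ (ham H₀ A J).domain := fun x =>
    ⟨fun h => ⟨h, hABd h⟩, fun h => h.1⟩
  have hham : ∀ x : H₀.domain,
      shift (ham H₀ A J) z ⟨x, (hdom x).1 x.2⟩ = e x - s (b x) := fun x => by
    refine (shift_apply (ham H₀ A J) z ⟨x, (hdom x).1 x.2⟩).trans ?_
    rw [hea, add_comm (H₀ x), add_sub_assoc]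
    rfl
  have hrho : z ∈ rho (ham H₀ A J) ↔ Function.Bijective (e.toLinearMap - s ∘ₗ b) := by
    have : ⇑(e.toLinearMap - s ∘ₗ b) =
        shift (ham H₀ A J) z ∘ Equiv.subtypeEquivRight hdom := by
      ext x; exact (hham x).symm
    rw [this]
    exact (Function.Bijective.of_comp_iff _ (Equiv.bijective _)).symm
  refine ⟨hφd, Φ, ⟨le_top, fun x y hxy => by rw [hφv, hxy]; rfl⟩, fun Ψ hΨ => ?_, ?_, fun hU => ?_⟩
  · refine ContinuousLinearMap.coeFn_injective
      (Continuous.ext_on hV Ψ.continuous Φ.continuous fun v hv => ?_)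
    exact ((mem_graph_full Ψ _ _).1 (LinearPMap.le_graph_of_le hΨ (hφ ⟨v, hv⟩)))
  · rw [hunit, ← hrho]
    exact ⟨fun h => ⟨hz, h⟩, fun h => h.2⟩
  · have hzH : z ∈ rho (ham H₀ A J) := hrho.2 (hunit.1 hU)
    obtain ⟨hf1, hf2⟩ := hform hU
    have hR : ∀ x y, (y, x) ∈ (res (ham H₀ A J) z).graph ↔
        ∃ x' : H₀.domain, (x' : 𝓗) = x ∧ e x' - s (b x') = y := fun x y => by
      rw [mem_graph_res _ hzH]
      constructor
      · rintro ⟨h, rfl⟩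
        exact ⟨⟨x, (hdom x).2 h⟩, rfl, (hham _).symm⟩
      · rintro ⟨x', rfl, rfl⟩
        exact ⟨_, hham x'⟩
    constructor
    -- With `y = (H + z) x`, `hf1` gives `(1 - Φ)⁻¹ B R₀(z) y = B x`, which lies in `D(A*)`, so the
    -- right side is `R₀(z) (y + A* B x) = x`.
    · refine eq_of_graph_le (fun y x hyx => ?_) (by rw [res_domain _ hzH]; exact le_top)
      obtain ⟨x, rfl, rfl⟩ := (hR _ _).1 hyx
      refine (mem_graph_add _ _ _ _).2 ⟨_, e.symm (s (b x)), (hR₀ _ _).2 rfl, ?_, ?_⟩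
      · refine (mem_graph_pcomp _ _ _ _).2 ⟨s (b x), (mem_graph_pcomp _ _ _ _).2 ⟨b x,
          (mem_graph_pcomp _ _ _ _).2 ⟨_, (mem_graph_pcomp _ _ _ _).2 ⟨_, (hR₀ _ _).2 rfl, hB _⟩,
            (mem_graph_full _ _ _).2 (hf1 x)⟩, A†.mem_graph (b x)⟩, (hR₀ _ _).2 rfl⟩
      · rw [← Submodule.coe_add, ← map_add, sub_add_cancel, e.symm_apply_apply]
    · refine eq_of_graph_le (fun v y hvy => ?_) fun v hv => ?_
      · obtain ⟨hv, rfl⟩ := (mem_graph_iff_exists _ _ _).1 hvy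
        obtain ⟨x, hx⟩ := hzH.2 (s ⟨v, hv⟩)
        have hx' := (hham ⟨x, (hdom x).2 x.2⟩).symm.trans hx
        refine (mem_graph_add _ _ _ _).2 ⟨v, _, (mem_graph_full _ _ _).2 rfl,
          (mem_graph_pcomp _ _ _ _).2 ⟨x, (mem_graph_pcomp _ _ _ _).2
            ⟨s ⟨v, hv⟩, A†.mem_graph ⟨v, hv⟩, (hR _ _).2 ⟨⟨x, (hdom x).2 x.2⟩, rfl, hx'⟩⟩,
            hB ⟨x, (hdom x).2 x.2⟩⟩, ?_⟩
        exact (hf2 ⟨v, hv⟩ _ hx').symm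
      · exact ((mem_pcomp_domain _ _ _).1 ((mem_pcomp_domain _ _ _).1 hv.2).1).1
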